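/- Let $\mathbf k$ be a commutative ring and $n\ge 0$ an integer. Write $[p]=\{1,\dots,p\}$ (so $[p]=\varnothing$ for $p\le 0$), let $S_p$ be the symmetric group of $[p]$ with product $(\pi\sigma)(x)=\pi(\sigma(x))$, and let $\mathcal A=\mathbf k[S_n]$. For $1\le i\le n-1$ let $s_i\in S_n$ be the transposition of $i$ and $i+1$. A set of integers is called lacunar if it contains no two consecutive integers. For $I\subseteq[n]$ put $I'=\{i\in[n-1] : i\notin I \text{ and } i+1\notin I\}$ and $$F(I)=\{q\in\mathcal A : q s_i=q\text{ for all } i\in I'\},$$ a left ideal of $\mathcal A$. Let $f_0=0$, $f_1=1$, $f_r=f_{r-1}+f_{r-2}$ be the Fibonacci numbers. Let $Q_1,\dots,Q_{f_{n+1}}$ be a list, without repetition, of all lacunar subsets of $[n-1]$ (there are $f_{n+1}$ of them) such that the sums of the elements satisfy $\operatorname{sum}Q_1\le\operatorname{sum}Q_2\le\cdots\le\operatorname{sum}Q_{f_{n+1}}$, and set $F_i=F(Q_1)+\cdots+F(Q_i)$ for $0\le i\le f_{n+1}$ (so $F_0=0$); each $F_i$ is a left ideal of $\mathcal A$. For $p\ge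 0$ let $\mathcal H_p$ be $\mathbf k$ with trivial $S_p$-action. For $p\ge 1$ let $\mathcal Z_p=\mathbf k^p/\{(a,\dots,a):a\in\mathbf k\}$, where $S_p$ acts on $\mathbf k^p$ by $(\sigma v)_x=v_{\sigma^{-1}(x)}$. For $j_1,\dots,j_m\ge 0$ with $j_1+\cdots+j_m=n$ and representations $U_k$ of $S_{j_k}$ over $\mathbf k$, the induction product is $$U_1*\cdots*U_m=\operatorname{Ind}_{S_{j_1}\times\cdots\times S_{j_m}}^{S_n}(U_1\otimes_{\mathbf k}\cdots\otimes_{\mathbf k} U_m),$$ where $S_{j_1}\times\cdots\times S_{j_m}$ is embedded in $S_n$ by letting $S_{j_k}$ permute the $k$-th of the consecutive intervals of lengths $j_1,\dots,j_m$ that make up $[n]$. **Theorem.** Let $i\in[f_{n+1}]$. Write $Q_i\cup\{n+1\}=\{i_1<i_2<\cdots<i_m\}$, set $i_0=1$, and set $j_k=i_k-i_{k-1}$ for $1\le k\le m$. Then $j_1\ge 0$, $j_2,\dots,j_m>1$, $j_1+\cdots+j_m=n$, and $$F_i/F_{i-1}\;\cong\;\mathcal H_{j_1}*\mathcal Z_{j_2}*\mathcal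 Z_{j_3}*\cdots*\mathcal Z_{j_m}$$ as representations of $S_n$, i.e. as left $\mathbf k[S_n]$-modules (the first factor is an $\mathcal H$, all others are $\mathcal Z$'s). -/

import Mathlib

open scoped TensorProduct

universe u

/-- A set of integers is lacunar if it contains no two consecutive integers. -/
def IsLacunar (I : Finset ℕ) : Prop := ∀ i ∈ I, i + 1 ∉ I

/-- The group algebra `k[S_n]`. The symmetric group `S_n` is `Equiv.Perm (Fin n)`, where the
element `x` of `{1, …, n}` is represented by `x - 1 : Fin n`. -/
abbrev SymmetricGroupAlgebra (k : Type u) [CommRing k] (n : ℕ) : Type u :=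
  MonoidAlgebra k (Equiv.Perm (Fin n))

/-- The simple transposition `s_i` for `1 ≤ i ≤ n - 1`, swapping `i` and `i + 1` in
`{1, …, n}` (that is, `i - 1` and `i` in `Fin n`). -/
def simpleTransposition (n i : ℕ) (h₁ : 1 ≤ i) (h₂ : i < n) : Equiv.Perm (Fin n) :=
  Equiv.swap ⟨i - 1, by omega⟩ ⟨i, h₂⟩

/-- The non-shadow `I'` of `I`: all `i ∈ {1, …, n - 1}` with `i ∉ I` and `i + 1 ∉ I`. -/
def nonShadow (n : ℕ) (I : Finset ℕ) : Finset ℕ :=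
  (Finset.Icc 1 (n - 1)).filter fun i => i ∉ I ∧ i + 1 ∉ I

/-- `F(I) = {q ∈ k[S_n] ∣ q s_i = q for all i ∈ I'}`, as a left ideal of `k[S_n]`. -/
noncomputable def lacunarIdeal (k : Type u) [CommRing k] (n : ℕ) (I : Finset ℕ) :
    Submodule (SymmetricGroupAlgebra k n) (SymmetricGroupAlgebra k n) where
  carrier := {q | ∀ (i : ℕ) (h₁ : 1 ≤ i) (h₂ : i < n), i ∈ nonShadow n I →
    q * MonoidAlgebra.single (simpleTransposition n i h₁ h₂) 1 = q}
  add_mem' := by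
    intro a b ha hb i h₁ h₂ hi
    rw [add_mul, ha i h₁ h₂ hi, hb i h₁ h₂ hi]
  zero_mem' := by
    intro i h₁ h₂ hi
    rw [zero_mul]
  smul_mem' := by
    intro c a ha i h₁ h₂ hi
    rw [smul_eq_mul, mul_assoc, ha i h₁ h₂ hi]

/-- The term `F_i = F(Q_1) + ⋯ + F(Q_i)` of the filtration of `k[S_n]` attached to a list
`Q_1, …, Q_N` of sets. The list is indexed from `0`, so that `Q_{s+1}` is `Q s`. -/
noncomputable def filtrationTerm (k : Type u) [CommRing k] (n : ℕ) {N : ℕ}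
    (Q : Fin N → Finset ℕ) (i : ℕ) : Submodule (SymmetricGroupAlgebra k n) (SymmetricGroupAlgebra k n) :=
  ⨆ (s : Fin N) (_ : s.val < i), lacunarIdeal k n (Q s)

/-- For `i_1 < ⋯ < i_{m+1}` (given as `a 0 < ⋯ < a m`) and `i_0 = 1`, the gaps
`i_k - i_{k-1}` for `k = 1, …, m + 1` (indexed from `0`). -/
def gaps {m : ℕ} (a : Fin (m + 1) → ℕ) (l : Fin (m + 1)) : ℕ :=
  (Fin.cons 1 a : Fin (m + 2) → ℕ) l.succ - (Fin.cons 1 a : Fin (m + 2) → ℕ) l.castSucc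

/-- The trivial representation `H_p` of `S_p` on `k`. -/
noncomputable def trivialRep (k : Type u) [CommRing k] (p : ℕ) :
    Rep.{u} k (Equiv.Perm (Fin p)) :=
  Rep.of (Representation.trivial k (Equiv.Perm (Fin p)) k)

/-- The natural representation `N_p` of `S_p` on `k^p`: `(σ v)_x = v_{σ⁻¹ x}`. -/
def naturalRep (k : Type u) [CommRing k] (p : ℕ) :
    Representation k (Equiv.Perm (Fin p)) (Fin p → k) where
  toFun σ := LinearMap.funLeft k k (σ⁻¹ : Equiv.Perm (Fin p))
  map_one' := rfl
  map_mul' _ _ := rfl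

/-- The submodule `D_p` of `k^p` of all vectors whose coordinates are all equal. -/
def diagonalSubmodule (k : Type u) [CommRing k] (p : ℕ) : Submodule k (Fin p → k) where
  carrier := {v | ∀ x y, v x = v y}
  add_mem' ha hb x y := congrArg₂ (· + ·) (ha x y) (hb x y)
  zero_mem' _ _ := rfl
  smul_mem' c _ hv x y := congrArg (c • ·) (hv x y)

/-- The reflection quotient representation `Z_p = N_p / D_p` of `S_p`. -/
noncomputable def reflectionQuotientRep (k : Type u) [CommRing k] (p : ℕ) :
    Rep.{u} k (Equiv.Perm (Fin p)) :=
  Rep.of ((naturalRep k p).quotient (diagonalSubmodule k p) fun _ _ hv _ _ => hv _ _)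

/-- The parabolic embedding `S_{j_1} × ⋯ × S_{j_m} → S_n` for `j_1 + ⋯ + j_m = n`: the `i`-th
factor permutes the `i`-th of the consecutive intervals of lengths `j_1, …, j_m`. -/
def parabolicEmbedding {m n : ℕ} (j : Fin m → ℕ) (h : ∑ i, j i = n) :
    (∀ i, Equiv.Perm (Fin (j i))) →* Equiv.Perm (Fin n) :=
  (Equiv.permCongrHom (finSigmaFinEquiv.trans (finCongr h))).toMonoidHom.comp
    (Equiv.Perm.sigmaCongrRightHom fun i => Fin (j i))

/-- The tensor product of representations of groups `G_i`, as a representation of `∏ G_i`. -/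
noncomputable def outerTensorProduct {k : Type u} [CommRing k] {m : ℕ} {G : Fin m → Type}
    [∀ i, Group (G i)] (U : ∀ i, Rep.{u} k (G i)) :
    Representation k (∀ i, G i) (⨂[k] i, (U i).V) where
  toFun g := PiTensorProduct.map fun i => (U i).ρ (g i)
  map_one' := by simp [PiTensorProduct.map_one]
  map_mul' g g' := by simp [PiTensorProduct.map_mul]

/-- The induction product `U_1 * ⋯ * U_m`, a representation of `S_n` for `n = j_1 + ⋯ + j_m`:
the tensor product `U_1 ⊗ ⋯ ⊗ U_m` induced along the parabolic embedding. -/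
noncomputable def inductionProduct {k : Type u} [CommRing k] {m n : ℕ} (j : Fin m → ℕ)
    (h : ∑ i, j i = n) (U : ∀ i, Rep.{u} k (Equiv.Perm (Fin (j i)))) :
    Representation k (Equiv.Perm (Fin n))
      (Representation.IndV (parabolicEmbedding j h) (outerTensorProduct U)) :=
  Representation.ind (parabolicEmbedding j h) (outerTensorProduct U)

/-- The family `H_{j_1}, Z_{j_2}, …, Z_{j_{m+1}}`. -/
noncomputable def fibonacciFactors (k : Type u) [CommRing k] {m : ℕ} (j : Fin (m + 1) → ℕ) :
    ∀ l, Rep.{u} k (Equiv.Perm (Fin (j l))) :=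
  Fin.cons (trivialRep k (j 0)) fun l => reflectionQuotientRep k (j l.succ)

/-!
# The Fibonacci filtration of the group algebra of the symmetric group

Write `Q = Q_i = {i_1 < ⋯ < i_{m-1}}`, and cut `{1, …, n}` into the blocks
`[1, i_1 - 1], [i_1, i_2 - 1], …, [i_{m-1}, n]`, whose lengths are the `j_k`. The non-shadow of `Q`
indexes the adjacent transpositions inside the blocks, except those which move the first letter
of a block other than the block `0`. They generate a Young subgroup, and `F(Q)` is the
left ideal generated by the sum `∇` of that subgroup (`lacunarIdeal_eq_span`). Hence
`F_i / F_{i-1}` is generated by the class of `∇`, just as `H_{j_1} * Z_{j_2} * ⋯ * Z_{j_m}` is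
generated by a pure tensor of generators of the factors. The two modules are compared by means of
right multiplication by `d = ∏_{c ∈ Q} (1 - s_c)`, where `s_c` swaps the first two letters of the
block starting at `c`.

* `F_{i-1} d = 0`. If `s < i`, then some `c ∈ Q_i` lies in the non-shadow of `Q_s`, as otherwise
  `c ↦ c` or `c + 1` would be an injection of `Q_i` into `Q_s` (`IsLacunar.eq_of_sum_le`); now
  `1 - s_c` kills `F(Q_s)` (`mul_groupAlgebraProd_alt_eq_zero`).
* The relations of the induction product hold modulo `F_{i-1}`. In `Z_p` the only relation is that
  vectors with equal coordinates vanish. In `F(Q)` they correspond to elements which are moreover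
  invariant under `s_c`, hence belong to `F(P)` where `P` is `Q` with `c` lowered to `c - 1`.
  Lowering elements further until the set is lacunar (`exists_isLacunar_nonShadow_subset`)
  shows that they lie in `F_{i-1}` (`groupAlgebraProd_mem_of_annihilates`).
* The first two points yield `Ind → F_i / F_{i-1} → k[S_n]`, with a surjective first map. The
  composite is induced from the map `v ↦ ∑_w (v_{w(1)} - v_{w(2)}) w` from `Z_p` to `k[S_p]`, which
  has a `k`-linear retraction, for any commutative ring `k` (`reflectionSplit`). So the composite
  is injective, and the first map is an isomorphism (`SplitCyclic.nonempty_linearEquiv_ind`).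
-/

/-! ### Multilinear maps on quotients -/

section MultilinearDescent

variable {k ι : Type*} [CommRing k] [Finite ι]
  {M U : ι → Type*} [∀ l, AddCommGroup (M l)] [∀ l, Module k (M l)]
  [∀ l, AddCommGroup (U l)] [∀ l, Module k (U l)] {X : Type*} [AddCommGroup X] [Module k X]

theorem MultilinearMap.apply_eq_of_map_eq (B : MultilinearMap k M X) (π : ∀ l, M l →ₗ[k] U l)
    (hB : ∀ f l, π l (f l) = 0 → B f = 0) {f f' : ∀ l, M l} (h : ∀ l, π l (f l) = π l (f' l)) :
    B f = B f' := by
  classical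
  have := Fintype.ofFinite ι
  -- change the arguments one at a time
  have key : ∀ s : Finset ι, B (s.piecewise f f') = B f' := by
    intro s
    induction s using Finset.induction_on with
    | empty => simp
    | insert l s hl ih =>
      rw [← ih, Finset.piecewise_insert, ← sub_eq_zero]
      have h1 : s.piecewise f f' = Function.update (s.piecewise f f') l (f' l) := by
        rw [eq_comm, Function.update_eq_self_iff]
        simp [hl]
      conv_lhs => rw [h1]
      rw [Function.update_idem, ← B.map_update_sub]
      exact hB _ l (by simp [h l])
  simpa using key Finset.univ

/-- A multilinear map which vanishes as soon as one argument lies in the kernel of the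
corresponding surjection `π l` descends along these surjections. -/
theorem MultilinearMap.exists_descent (B : MultilinearMap k M X) (π : ∀ l, M l →ₗ[k] U l)
    (hπ : ∀ l, Function.Surjective (π l)) (hB : ∀ f l, π l (f l) = 0 → B f = 0) :
    ∃ B' : MultilinearMap k U X, ∀ f, B' (fun l => π l (f l)) = B f := by
  classical
  choose σ hσ using hπ
  refine ⟨{ toFun := fun v => B fun l => σ l (v l)
            map_update_add' := ?_
            map_update_smul' := ?_ }, fun f => ?_⟩
  · intro _ v l x y
    have e : ∀ z, B (fun l' => σ l' (Function.update v l z l')) =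
        B (Function.update (fun l' => σ l' (v l')) l (σ l z)) := by
      intro z
      congr 1
      ext l'
      rcases eq_or_ne l' l with rfl | h
      · simp
      · simp [h]
    rw [e, e, e, ← B.map_update_add]
    refine B.apply_eq_of_map_eq π hB fun l' => ?_
    rcases eq_or_ne l' l with rfl | h
    · simp [hσ]
    · simp [h]
  · intro _ v l c x
    have e : ∀ z, B (fun l' => σ l' (Function.update v l z l')) =
        B (Function.update (fun l' => σ l' (v l')) l (σ l z)) := by
      intro z
      congr 1
      ext l'
      rcases eq_or_ne l' l with rfl | h
      · simp
      · simp [h]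
    rw [e, e, ← B.map_update_smul]
    refine B.apply_eq_of_map_eq π hB fun l' => ?_
    rcases eq_or_ne l' l with rfl | h
    · simp [hσ]
    · simp [h]
  · exact B.apply_eq_of_map_eq π hB fun l => by simp [hσ]

end MultilinearDescent

/-! ### Products of group algebras -/

section OuterProduct

variable {k : Type u} [CommRing k] {m : ℕ} {G : Fin m → Type} [∀ l, Group (G l)]
  [∀ l, Fintype (G l)] {S : Type} [Group S]

/-- The multilinear extension `∏ k[G_l] → k[S]` of a homomorphism `∏ G_l → S`. -/
noncomputable def groupAlgebraProd (k : Type u) [CommRing k] (e : (∀ l, G l) →* S) :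
    MultilinearMap k (fun l => MonoidAlgebra k (G l)) (MonoidAlgebra k S) :=
  ∑ y : (∀ l, G l), ((MultilinearMap.mkPiAlgebra k (Fin m) k).compLinearMap fun l =>
    (Finsupp.lapply (y l)).comp (MonoidAlgebra.coeffLinearEquiv k).toLinearMap).smulRight
      (MonoidAlgebra.single (e y) (1 : k))

theorem groupAlgebraProd_apply (e : (∀ l, G l) →* S) (f : ∀ l, MonoidAlgebra k (G l)) :
    groupAlgebraProd k e f = ∑ y, MonoidAlgebra.single (e y) (∏ l, (f l).coeff (y l)) := by
  simp [groupAlgebraProd]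

theorem groupAlgebraProd_single (e : (∀ l, G l) →* S) (y : ∀ l, G l) :
    groupAlgebraProd k e (fun l => MonoidAlgebra.single (y l) (1 : k)) =
      MonoidAlgebra.single (e y) 1 := by
  classical
  rw [groupAlgebraProd_apply, Finset.sum_eq_single y]
  · simp
  · intro z _ hz
    obtain ⟨l, hl⟩ := Function.ne_iff.mp hz
    rw [Finset.prod_eq_zero (Finset.mem_univ l)]
    · simp
    · simp [hl.symm]
  · simp

omit [∀ l, Group (G l)] [∀ l, Fintype (G l)] in
/-- Multilinear maps out of group algebras are determined on group elements. -/
theorem MultilinearMap.monoidAlgebra_ext {X : Type*} [AddCommGroup X] [Module k X]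
    {B B' : MultilinearMap k (fun l => MonoidAlgebra k (G l)) X}
    (h : ∀ y : ∀ l, G l, B (fun l => MonoidAlgebra.single (y l) 1) =
      B' (fun l => MonoidAlgebra.single (y l) 1)) : B = B' := by
  refine Module.Basis.ext_multilinear (fun l => Module.Basis.ofRepr
    (MonoidAlgebra.coeffLinearEquiv (S := k) (M := G l) k)) fun y => ?_
  exact h y

/-- `groupAlgebraProd` is multiplicative, as the factors `G l` commute with each other in their
product. -/
theorem groupAlgebraProd_mul (e : (∀ l, G l) →* S) (f f' : ∀ l, MonoidAlgebra k (G l)) :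
    groupAlgebraProd k e (fun l => f l * f' l) =
      groupAlgebraProd k e f * groupAlgebraProd k e f' := by
  have key : ∀ y : ∀ l, G l, ∀ f', groupAlgebraProd k e
      (fun l => MonoidAlgebra.single (y l) 1 * f' l) =
      MonoidAlgebra.single (e y) 1 * groupAlgebraProd k e f' := by
    intro y f'
    refine congrFun (congrArg (⇑) (MultilinearMap.monoidAlgebra_ext
      (B := (groupAlgebraProd k e).compLinearMap fun l =>
        LinearMap.mulLeft k (MonoidAlgebra.single (y l) (1 : k)))
      (B' := (LinearMap.mulLeft k (MonoidAlgebra.single (e y) (1 : k))).compMultilinearMap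
        (groupAlgebraProd k e)) fun z => ?_)) f'
    have := groupAlgebraProd_single (k := k) e (y * z)
    simp only [Pi.mul_apply, map_mul] at this
    simp [MonoidAlgebra.single_mul_single, groupAlgebraProd_single, this]
  refine congrFun (congrArg (⇑) (MultilinearMap.monoidAlgebra_ext
      (B := (groupAlgebraProd k e).compLinearMap fun l => LinearMap.mulRight k (f' l))
      (B' := (LinearMap.mulRight k (groupAlgebraProd k e f')).compMultilinearMap
        (groupAlgebraProd k e)) fun y => ?_)) f
  simp [groupAlgebraProd_single, key]

/-- A presentation of a representation `V` of a group `G` both as a quotient and, `k`-linearly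
split, as a left ideal of `k[G]`: a generator `gen` of `V` and elements `sym`, `alt` of `k[G]` with
`V ≅ k[G] * sym * alt` via `gen ↦ sym * alt`. The linear map `retract` need not be equivariant;
its existence keeps the embedding injective under tensor products over any `k`. -/
structure SplitCyclic {G V : Type*} [Group G] [AddCommGroup V] [Module k V]
    (ρ : Representation k G V) where
  gen : V
  sym : MonoidAlgebra k G
  alt : MonoidAlgebra k G
  embed : V →ₗ[k] MonoidAlgebra k G
  retract : MonoidAlgebra k G →ₗ[k] V
  surj : ∀ v, ∃ f, ρ.asAlgebraHom f gen = v
  embed_rho : ∀ g v, embed (ρ g v) = MonoidAlgebra.single g 1 * embed v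
  embed_gen : embed gen = sym * alt
  retract_embed : ∀ v, retract (embed v) = v

variable {U : ∀ l, Rep.{u} k (G l)}

theorem SplitCyclic.embed_asAlgebraHom {G V : Type*} [Group G] [AddCommGroup V] [Module k V]
    {ρ : Representation k G V} (D : SplitCyclic ρ) (f : MonoidAlgebra k G) (v : V) :
    D.embed (ρ.asAlgebraHom f v) = f * D.embed v := by
  induction f using MonoidAlgebra.induction_on with
  | of g => simp [D.embed_rho]
  | add f f' h h' => simp [h, h', add_mul]
  | smul c f h => simp [h]

end OuterProduct

/-! ### Induction from a product of groups -/

section Induced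

variable {k : Type u} [CommRing k] {m : ℕ} {G : Fin m → Type} [∀ l, Group (G l)]
  {S : Type} [Group S] {U : ∀ l, Rep.{u} k (G l)}

theorem outerTensorProduct_tprod (y : ∀ l, G l) (v : ∀ l, (U l).V) :
    outerTensorProduct U y (PiTensorProduct.tprod k v) =
      PiTensorProduct.tprod k fun l => (U l).ρ (y l) (v l) := by
  simp [outerTensorProduct]

/-- The relation defining the induced representation, for pure tensors. Since `S` acts on
`IndV.mk s v` by `s ↦ s * g⁻¹`, the class of `s` stands for the translate by `s⁻¹`. -/
theorem indV_mk_hom (e : (∀ l, G l) →* S) (h : S) (y : ∀ l, G l) (v : ∀ l, (U l).V) :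
    Representation.IndV.mk e (outerTensorProduct U) (e y * h)
        (PiTensorProduct.tprod k fun l => (U l).ρ (y l) (v l)) =
      Representation.IndV.mk e (outerTensorProduct U) h (PiTensorProduct.tprod k v) := by
  rw [← outerTensorProduct_tprod]
  have := Representation.Coinvariants.mk_self_apply
    (Representation.tprod ((Representation.leftRegular k S).comp e) (outerTensorProduct U)) y
    (MonoidAlgebra.single h (1 : k) ⊗ₜ PiTensorProduct.tprod k v)
  simpa using this

theorem indV_hom_ext (e : (∀ l, G l) →* S) {X : Type*} [AddCommGroup X] [Module k X]
    {f g : Representation.IndV e (outerTensorProduct U) →ₗ[k] X}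
    (h : ∀ s v, f (Representation.IndV.mk e (outerTensorProduct U) s (PiTensorProduct.tprod k v)) =
      g (Representation.IndV.mk e (outerTensorProduct U) s (PiTensorProduct.tprod k v))) :
    f = g := by
  refine Representation.IndV.hom_ext _ _ fun s => PiTensorProduct.ext ?_
  ext v
  exact h s v

/-- The linear map out of an induced representation given by an equivariant multilinear map. -/
theorem exists_indV_lift (e : (∀ l, G l) →* S) {X : Type*} [AddCommGroup X] [Module k X]
    [Module (MonoidAlgebra k S) X] [IsScalarTower k (MonoidAlgebra k S) X]
    (B : MultilinearMap k (fun l => (U l).V) X)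
    (hB : ∀ y v, B (fun l => (U l).ρ (y l) (v l)) = MonoidAlgebra.single (e y) (1 : k) • B v) :
    ∃ Ψ : (Representation.ind e (outerTensorProduct U)).asModule →ₗ[MonoidAlgebra k S] X,
      ∀ s v, Ψ (Representation.IndV.mk e (outerTensorProduct U) s (PiTensorProduct.tprod k v)) =
        MonoidAlgebra.single s⁻¹ (1 : k) • B v := by
  let ψ : Representation.IndV e (outerTensorProduct U) →ₗ[k] X :=
    Representation.Coinvariants.lift _ (TensorProduct.lift
      ((Finsupp.lift (PiTensorProduct k (fun l => (U l).V) →ₗ[k] X) k S fun s =>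
        (Algebra.lsmul k k X (MonoidAlgebra.single s⁻¹ (1 : k))) ∘ₗ PiTensorProduct.lift B) ∘ₗ
      (MonoidAlgebra.coeffLinearEquiv k).toLinearMap)) (by
        intro y
        refine TensorProduct.ext <| MonoidAlgebra.lhom_ext' fun h =>
          LinearMap.ext_ring <| PiTensorProduct.ext ?_
        ext v
        simp [outerTensorProduct_tprod, hB, smul_smul, MonoidAlgebra.single_mul_single])
  have hψ : ∀ s v, ψ (Representation.IndV.mk e (outerTensorProduct U) s
      (PiTensorProduct.tprod k v)) = MonoidAlgebra.single s⁻¹ (1 : k) • B v := by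
    intro s v
    simp [ψ]
  refine ⟨MonoidAlgebra.equivariantOfLinearOfComm
    (ψ ∘ₗ (Representation.ind e (outerTensorProduct U)).asModuleEquiv.toLinearMap) ?_, hψ⟩
  intro g v
  have : ψ ∘ₗ (Representation.ind e (outerTensorProduct U) g) =
      (Algebra.lsmul k k X (MonoidAlgebra.single g (1 : k))) ∘ₗ ψ := by
    refine indV_hom_ext e fun s v => ?_
    refine (congrArg ψ (Representation.ind_mk e (outerTensorProduct U) g s
      (PiTensorProduct.tprod k v))).trans ((hψ _ v).trans ?_)
    rw [LinearMap.comp_apply, hψ]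
    simp [smul_smul, MonoidAlgebra.single_mul_single]
  rw [Representation.single_smul, one_smul]
  exact LinearMap.congr_fun this v

/-- Splitting `S` into left cosets of the image of `e`, a family of linear maps
`r l : k[G_l] → U_l` extends to a linear map from `k[S]` to the induced representation. -/
theorem exists_induced_retract (e : (∀ l, G l) →* S) (he : Function.Injective e)
    [∀ l, Fintype (G l)] (r : ∀ l, MonoidAlgebra k (G l) →ₗ[k] (U l).V) :
    ∃ R : MonoidAlgebra k S →ₗ[k] Representation.IndV e (outerTensorProduct U),
      ∀ s, ∃ t y, s = t * e y ∧ ∀ f,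
        R (MonoidAlgebra.single s 1 * groupAlgebraProd k e f) =
          Representation.IndV.mk e (outerTensorProduct U) t⁻¹ (PiTensorProduct.tprod k fun l =>
            r l (MonoidAlgebra.single (y l) 1 * f l)) := by
  -- every `s` is `t s * e (y s)` with `t s` the representative of the left coset of `s`
  let t : S → S := fun s => (s : S ⧸ e.range).out
  have ht : ∀ s, ∃ y, s = t s * e y := by
    intro s
    obtain ⟨⟨_, y, rfl⟩, h⟩ := QuotientGroup.mk_out_eq_mul e.range s
    exact ⟨y⁻¹, by simp [t, h]⟩
  choose y hy using ht
  have htm : ∀ s z, t (s * e z) = t s := by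
    intro s z
    simp only [t]
    congr 1
    rw [QuotientGroup.eq]
    exact ⟨z⁻¹, by simp⟩
  have hym : ∀ s z, y (s * e z) = y s * z := by
    intro s z
    apply he
    have := hy (s * e z)
    rw [htm] at this
    conv_lhs at this => rw [hy s]
    rw [mul_assoc] at this
    simpa using (mul_left_cancel this).symm
  let R : MonoidAlgebra k S →ₗ[k] Representation.IndV e (outerTensorProduct U) :=
    (Finsupp.lift (Representation.IndV e (outerTensorProduct U)) k S fun s =>
      Representation.IndV.mk e (outerTensorProduct U) (t s)⁻¹ (PiTensorProduct.tprod k fun l =>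
            r l (MonoidAlgebra.single (y s l) 1))) ∘ₗ
      (MonoidAlgebra.coeffLinearEquiv k).toLinearMap
  have hR : ∀ s, R (MonoidAlgebra.single s 1) = Representation.IndV.mk e (outerTensorProduct U)
      (t s)⁻¹ (PiTensorProduct.tprod k fun l => r l (MonoidAlgebra.single (y s l) 1)) := by
    intro s
    simp [R]
  refine ⟨R, fun s => ⟨t s, y s, hy s, fun f => ?_⟩⟩
  refine congrFun (congrArg (⇑) (MultilinearMap.monoidAlgebra_ext
      (B := (R ∘ₗ LinearMap.mulLeft k (MonoidAlgebra.single s (1 : k))).compMultilinearMap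
        (groupAlgebraProd k e))
      (B' := ((Representation.IndV.mk e (outerTensorProduct U) (t s)⁻¹).compMultilinearMap
        (PiTensorProduct.tprod k)).compLinearMap fun l =>
          r l ∘ₗ LinearMap.mulLeft k (MonoidAlgebra.single (y s l) (1 : k))) fun z => ?_)) f
  have := hR (s * e z)
  rw [htm, hym] at this
  simpa [groupAlgebraProd_single, MonoidAlgebra.single_mul_single] using this

/-- Criterion for a subquotient `F / N` of the regular representation to be the representation
induced from a tensor product of representations `U l`: by `hvan` the relations between the
generators of the `U l` hold in `F / N`, and by `hN` right multiplication by the product of the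
elements `alt` is defined on `F / N`, which shows that there are no further relations. -/
theorem SplitCyclic.nonempty_linearEquiv_ind [∀ l, Fintype (G l)]
    (e : (∀ l, G l) →* S) (he : Function.Injective e)
    (D : ∀ l, SplitCyclic (U l).ρ) (N F : Submodule (MonoidAlgebra k S) (MonoidAlgebra k S))
    (hF : F = N ⊔ Submodule.span _ {groupAlgebraProd k e fun l => (D l).sym})
    (hN : ∀ q ∈ N, q * groupAlgebraProd k e (fun l => (D l).alt) = 0)
    (hvan : ∀ (f : ∀ l, MonoidAlgebra k (G l)) (l), (U l).ρ.asAlgebraHom (f l) (D l).gen = 0 →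
      groupAlgebraProd k e (fun l => f l * (D l).sym) ∈ N) :
    Nonempty ((↥F ⧸ N.submoduleOf F) ≃ₗ[MonoidAlgebra k S]
      (Representation.ind e (outerTensorProduct U)).asModule) := by
  let π : ∀ l, MonoidAlgebra k (G l) →ₗ[k] (U l).V := fun l =>
    (LinearMap.applyₗ (D l).gen) ∘ₗ (U l).ρ.asAlgebraHom.toLinearMap
  -- `f ↦ Θ(f) ∇` modulo `N`, where `Θ = groupAlgebraProd k e` and `∇` is the product of the
  -- elements `sym`, only depends on the images `f l • gen` in `U l`
  obtain ⟨B, hB⟩ := MultilinearMap.exists_descent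
    ((N.mkQ.restrictScalars k).compMultilinearMap ((groupAlgebraProd k e).compLinearMap fun l =>
      LinearMap.mulRight k (D l).sym)) π (fun l v => (D l).surj v) (fun f l h => by
        simpa using hvan f l h)
  replace hB : ∀ f : ∀ l, MonoidAlgebra k (G l), B (fun l => (U l).ρ.asAlgebraHom (f l) (D l).gen) =
      N.mkQ (groupAlgebraProd k e (fun l => f l * (D l).sym)) := hB
  have hsurj : ∀ v : ∀ l, (U l).V, ∃ f : ∀ l, MonoidAlgebra k (G l),
      (fun l => (U l).ρ.asAlgebraHom (f l) (D l).gen) = v := by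
    intro v
    choose f hf using fun l => (D l).surj (v l)
    exact ⟨f, funext hf⟩
  obtain ⟨Ψ, hΨ⟩ := exists_indV_lift e B (by
    intro y v
    obtain ⟨f, rfl⟩ := hsurj v
    have := hB fun l => MonoidAlgebra.single (y l) 1 * f l
    simp only [map_mul, mul_assoc, groupAlgebraProd_mul, groupAlgebraProd_single] at this
    simp only [hB, groupAlgebraProd_mul, ← map_smul, smul_eq_mul]
    simpa using this)
  have hinj : Function.Injective Ψ := by
    -- `δ ∘ Ψ` is induced from the tensor product of the embeddings, hence split by `R`
    let δ : (MonoidAlgebra k S ⧸ N) →ₗ[MonoidAlgebra k S] MonoidAlgebra k S :=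
      N.liftQ (LinearMap.toSpanSingleton _ _ (groupAlgebraProd k e fun l => (D l).alt)) (by
        intro q hq
        simpa using hN q hq)
    obtain ⟨R, hR⟩ := exists_induced_retract e he fun l => (D l).retract
    have hid : R ∘ₗ (δ.restrictScalars k) ∘ₗ (Ψ.restrictScalars k) ∘ₗ
        (Representation.ind e (outerTensorProduct U)).asModuleEquiv.symm.toLinearMap =
        LinearMap.id := by
      refine indV_hom_ext e fun s v => ?_
      obtain ⟨t, y, hs, h⟩ := hR s⁻¹
      have h1 : δ (B v) = groupAlgebraProd k e fun l => (D l).embed (v l) := by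
        obtain ⟨f, rfl⟩ := hsurj v
        rw [hB]
        simp only [δ, Submodule.mkQ_apply, Submodule.liftQ_apply,
          LinearMap.toSpanSingleton_apply, smul_eq_mul]
        rw [← groupAlgebraProd_mul]
        congr 1
        ext1 l
        rw [(D l).embed_asAlgebraHom, (D l).embed_gen, mul_assoc]
      have h2 := hΨ s v
      have h3 : R (δ (Ψ (Representation.IndV.mk e (outerTensorProduct U) s
          (PiTensorProduct.tprod k v)))) = Representation.IndV.mk e (outerTensorProduct U) s
          (PiTensorProduct.tprod k v) := by
        rw [h2, map_smul, h1, smul_eq_mul, h]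
        simp only [← SplitCyclic.embed_rho, SplitCyclic.retract_embed]
        rw [← indV_mk_hom e s y v]
        congr 2
        rw [eq_comm, ← inv_inj, mul_inv_rev, hs]
        simp
      exact h3
    intro x x' h
    have h1 := LinearMap.congr_fun hid x
    have h2 := LinearMap.congr_fun hid x'
    have h3 : R (δ (Ψ x)) = R (δ (Ψ x')) := by rw [h]
    exact h1.symm.trans (h3.trans h2)
  have hrange : LinearMap.range Ψ = LinearMap.range (N.mkQ.domRestrict F) := by
    rw [LinearMap.range_domRestrict, hF, Submodule.map_sup]
    rw [Submodule.mkQ_map_self, bot_sup_eq, Submodule.map_span, Set.image_singleton]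
    apply le_antisymm
    · set P := Submodule.span (MonoidAlgebra k S)
        {N.mkQ (groupAlgebraProd k e fun l => (D l).sym)}
      have h1 : (P.mkQ.restrictScalars k) ∘ₗ (Ψ.restrictScalars k) ∘ₗ
          (Representation.ind e (outerTensorProduct U)).asModuleEquiv.symm.toLinearMap = 0 := by
        refine indV_hom_ext e fun s v => ?_
        obtain ⟨f, rfl⟩ := hsurj v
        refine (Submodule.Quotient.mk_eq_zero P).mpr ?_
        refine (congrArg (· ∈ P) (hΨ s _)).mpr ?_
        rw [hB, groupAlgebraProd_mul, ← smul_eq_mul, map_smul]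
        exact P.smul_mem _ (P.smul_mem _ (Submodule.mem_span_singleton_self _))
      rintro _ ⟨x, rfl⟩
      exact (Submodule.Quotient.mk_eq_zero P).mp (LinearMap.congr_fun h1 x)
    · rw [Submodule.span_singleton_le_iff_mem]
      refine ⟨_, (hΨ 1 (fun l => (D l).gen)).trans ?_⟩
      have := hB 1
      simpa [← MonoidAlgebra.one_def] using this
  have hker : LinearMap.ker (N.mkQ.domRestrict F) = N.submoduleOf F := by
    rw [LinearMap.ker_domRestrict, Submodule.ker_mkQ]
    rfl
  exact ⟨(Submodule.quotEquivOfEq _ _ hker.symm).trans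
    ((N.mkQ.domRestrict F).quotKerEquivRange.trans
      ((LinearEquiv.ofEq _ _ hrange.symm).trans (LinearEquiv.ofInjective Ψ hinj).symm))⟩

end Induced

/-! ### The trivial and the reflection quotient representation -/

section LocalFactors

variable (k : Type u) [CommRing k]

/-- The sum of all elements of a finite group. -/
noncomputable def groupSum (G : Type*) [Group G] [Fintype G] : MonoidAlgebra k G :=
  ∑ w, MonoidAlgebra.single w 1

theorem single_mul_groupSum {G : Type*} [Group G] [Fintype G] (g : G) :
    MonoidAlgebra.single g 1 * groupSum k G = groupSum k G := by
  rw [groupSum, Finset.mul_sum]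
  exact Fintype.sum_equiv (Equiv.mulLeft g) _ _ fun w => by simp [MonoidAlgebra.single_mul_single]

theorem coeff_sum_single {G : Type*} [Fintype G] (c : G → k) (g : G) :
    (∑ w, MonoidAlgebra.single w (c w)).coeff g = c g := by
  classical
  simp [Finsupp.single_apply]

/-- The trivial representation as the left ideal of `k[G]` spanned by the sum of all elements
of `G`. -/
noncomputable def trivialSplit (G : Type*) [Group G] [Fintype G] :
    SplitCyclic (Representation.trivial k G k) where
  gen := 1
  sym := groupSum k G
  alt := 1
  embed := LinearMap.toSpanSingleton k _ (groupSum k G)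
  retract := (Finsupp.lapply (1 : G)).comp (MonoidAlgebra.coeffLinearEquiv k).toLinearMap
  surj v := ⟨MonoidAlgebra.single 1 v, by simp⟩
  embed_rho g v := by
    rw [LinearMap.toSpanSingleton_apply, LinearMap.toSpanSingleton_apply, mul_smul_comm,
      single_mul_groupSum]
    rfl
  embed_gen := by simp
  retract_embed v := by
    simp [groupSum]

theorem trivialSplit_mul_sym {G : Type*} [Group G] [Fintype G] (f : MonoidAlgebra k G)
    (hf : (Representation.trivial k G k).asAlgebraHom f (trivialSplit k G).gen = 0) :
    f * (trivialSplit k G).sym = 0 := by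
  have : f * (trivialSplit k G).sym = (trivialSplit k G).embed
      ((Representation.trivial k G k).asAlgebraHom f (trivialSplit k G).gen) := by
    rw [SplitCyclic.embed_asAlgebraHom, SplitCyclic.embed_gen]
    simp [trivialSplit]
  rw [this, hf, map_zero]

variable {p : ℕ}

theorem diagonalSubmodule_le_comap (σ : Equiv.Perm (Fin p)) :
    diagonalSubmodule k p ≤ (diagonalSubmodule k p).comap (naturalRep k p σ) :=
  fun _ hv _ _ => hv _ _

theorem naturalRep_single (σ : Equiv.Perm (Fin p)) (x : Fin p) :
    naturalRep k p σ (Pi.single x 1) = Pi.single (σ x) 1 := by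
  ext y
  change (Pi.single x (1 : k) : Fin p → k) (σ⁻¹ y) = _
  simp only [Pi.single_apply, Equiv.Perm.inv_eq_iff_eq]

variable (hp : 2 ≤ p)

/-- The first letter of a block with at least two letters. -/
def firstLetter : Fin p := ⟨0, by omega⟩

/-- The second letter of a block with at least two letters. -/
def secondLetter : Fin p := ⟨1, by omega⟩

theorem firstLetter_ne_secondLetter : firstLetter hp ≠ secondLetter hp := by
  simp [firstLetter, secondLetter]

/-- The sum of all permutations which fix the first letter. -/
noncomputable def stabilizerSum : MonoidAlgebra k (Equiv.Perm (Fin p)) :=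
  ∑ w with w (firstLetter hp) = firstLetter hp, MonoidAlgebra.single w 1

/-- The embedding of `k^p / D_p` in `k[S_p]` sending `v` to `∑_w (v_{w(1)} - v_{w(2)}) w`. -/
noncomputable def reflectionEmbed :
    ((Fin p → k) ⧸ diagonalSubmodule k p) →ₗ[k] MonoidAlgebra k (Equiv.Perm (Fin p)) :=
  (diagonalSubmodule k p).liftQ
    (∑ w : Equiv.Perm (Fin p), MonoidAlgebra.lsingle w ∘ₗ
      ((LinearMap.proj (w (firstLetter hp)) : (Fin p → k) →ₗ[k] k) -
        LinearMap.proj (w (secondLetter hp)))) (by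
    intro v hv
    rw [LinearMap.mem_ker, LinearMap.sum_apply]
    refine Finset.sum_eq_zero fun w _ => ?_
    change MonoidAlgebra.single w (v (w (firstLetter hp)) - v (w (secondLetter hp))) = 0
    rw [hv (w (firstLetter hp)) (w (secondLetter hp)), sub_self, MonoidAlgebra.single_zero])

theorem reflectionEmbed_mk (v : Fin p → k) :
    reflectionEmbed k hp (Submodule.Quotient.mk v) = ∑ w : Equiv.Perm (Fin p),
      MonoidAlgebra.single w (v (w (firstLetter hp)) - v (w (secondLetter hp))) := by
  rw [reflectionEmbed, Submodule.liftQ_apply, LinearMap.sum_apply]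
  rfl

/-- Multiplication by `stabilizerSum` computes the action on the first basis vector of `k^p`. -/
theorem mul_stabilizerSum (f : MonoidAlgebra k (Equiv.Perm (Fin p))) :
    f * stabilizerSum k hp = ∑ w, MonoidAlgebra.single w
      ((naturalRep k p).asAlgebraHom f (Pi.single (firstLetter hp) 1) (w (firstLetter hp))) := by
  induction f using MonoidAlgebra.induction_on with
  | of g =>
    rw [Representation.asAlgebraHom_of, naturalRep_single, stabilizerSum, Finset.mul_sum,
      Finset.sum_filter]
    refine Fintype.sum_equiv (Equiv.mulLeft g) _ _ fun w => ?_
    by_cases h : w (firstLetter hp) = firstLetter hp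
    · simp [h, MonoidAlgebra.single_mul_single]
    · simp [h]
  | add f f' h h' => simp [h, h', add_mul, Finset.sum_add_distrib]
  | smul c f h => simp [h, Finset.smul_sum]

theorem quotient_asAlgebraHom_mk (f : MonoidAlgebra k (Equiv.Perm (Fin p))) (v : Fin p → k) :
    ((naturalRep k p).quotient _ (diagonalSubmodule_le_comap k)).asAlgebraHom f
      (Submodule.Quotient.mk v) = Submodule.Quotient.mk ((naturalRep k p).asAlgebraHom f v) := by
  induction f using MonoidAlgebra.induction_on with
  | of g =>
    rw [Representation.asAlgebraHom_of, Representation.asAlgebraHom_of]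
    rfl
  | add f f' h h' => simp [h, h']
  | smul c f h => simp [h]

/-- The representation `k^p / D_p` as the left ideal of `k[S_p]` generated by
`(∑_{w(1) = 1} w) (1 - s_1)`. -/
noncomputable def reflectionSplit :
    SplitCyclic ((naturalRep k p).quotient _ (diagonalSubmodule_le_comap k)) where
  gen := Submodule.Quotient.mk (Pi.single (firstLetter hp) 1)
  sym := stabilizerSum k hp
  alt := 1 - MonoidAlgebra.single (Equiv.swap (firstLetter hp) (secondLetter hp)) 1
  embed := reflectionEmbed k hp
  -- The permutation below maps `1` to `x` and `2` to `1`, so `v` is recovered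
  -- from the differences `v_x - v_1` for `x ≠ 1`.
  retract := ∑ x ∈ Finset.univ.erase (firstLetter hp),
    ((Finsupp.lapply (Equiv.swap (secondLetter hp) x *
        Equiv.swap (firstLetter hp) (secondLetter hp))).comp
      (MonoidAlgebra.coeffLinearEquiv k).toLinearMap).smulRight
      (Submodule.Quotient.mk (Pi.single x 1))
  surj v := by
    obtain ⟨v, rfl⟩ := Submodule.Quotient.mk_surjective _ v
    refine ⟨∑ x, MonoidAlgebra.single (Equiv.swap (firstLetter hp) x) (v x), ?_⟩
    rw [quotient_asAlgebraHom_mk]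
    congr 1
    rw [map_sum, LinearMap.sum_apply]
    conv_rhs => rw [← Finset.univ_sum_single v]
    refine Finset.sum_congr rfl fun x _ => ?_
    rw [Representation.asAlgebraHom_single, LinearMap.smul_apply, naturalRep_single,
      Equiv.swap_apply_left, ← Pi.single_smul, smul_eq_mul, mul_one]
  embed_rho g v := by
    obtain ⟨v, rfl⟩ := Submodule.Quotient.mk_surjective _ v
    have : (naturalRep k p).quotient _ (diagonalSubmodule_le_comap k) g
        (Submodule.Quotient.mk v) = Submodule.Quotient.mk (naturalRep k p g v) := rfl
    rw [this, reflectionEmbed_mk, reflectionEmbed_mk, Finset.mul_sum]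
    refine (Fintype.sum_equiv (Equiv.mulLeft g) _ _ fun w => ?_).symm
    simp [MonoidAlgebra.single_mul_single, naturalRep, LinearMap.funLeft, mul_sub]
  embed_gen := by
    have h0 := mul_stabilizerSum k hp 1
    rw [one_mul, map_one] at h0
    rw [reflectionEmbed_mk, mul_sub, mul_one, h0, Finset.sum_mul]
    simp only [MonoidAlgebra.single_sub, Finset.sum_sub_distrib]
    congr 1
    refine Fintype.sum_equiv (Equiv.mulRight (Equiv.swap (firstLetter hp) (secondLetter hp))) _ _
      fun w => ?_
    simp [MonoidAlgebra.single_mul_single, mul_assoc]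
  retract_embed v := by
    obtain ⟨v, rfl⟩ := Submodule.Quotient.mk_surjective _ v
    have h1 : ∀ x ∈ Finset.univ.erase (firstLetter hp),
        Equiv.swap (secondLetter hp) x (firstLetter hp) = firstLetter hp := fun x hx =>
      Equiv.swap_apply_of_ne_of_ne (firstLetter_ne_secondLetter hp) (Finset.ne_of_mem_erase hx).symm
    have h2 : ∀ x ∈ Finset.univ.erase (firstLetter hp),
        (((Finsupp.lapply (Equiv.swap (secondLetter hp) x *
        Equiv.swap (firstLetter hp) (secondLetter hp))).comp
      (MonoidAlgebra.coeffLinearEquiv k).toLinearMap).smulRight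
      (Submodule.Quotient.mk (Pi.single x 1) : (Fin p → k) ⧸ diagonalSubmodule k p))
        (reflectionEmbed k hp (Submodule.Quotient.mk v)) =
        (v x - v (firstLetter hp)) • Submodule.Quotient.mk (Pi.single x 1) := by
      intro x hx
      rw [reflectionEmbed_mk, LinearMap.smulRight_apply, LinearMap.comp_apply]
      congr 1
      refine (coeff_sum_single k _ _).trans ?_
      simp [h1 x hx]
    rw [LinearMap.sum_apply, Finset.sum_congr rfl h2, Finset.sum_erase _ (by simp)]
    simp only [← Submodule.Quotient.mk_smul]
    rw [← Submodule.mkQ_apply]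
    simp only [← Submodule.mkQ_apply]
    rw [← map_sum, Submodule.mkQ_apply, Submodule.mkQ_apply, Submodule.Quotient.eq]
    intro x y
    simp [Finset.sum_apply, Pi.single_apply]

theorem reflectionSplit_mul_sym (f : MonoidAlgebra k (Equiv.Perm (Fin p)))
    (hf : ((naturalRep k p).quotient _ (diagonalSubmodule_le_comap k)).asAlgebraHom f
      (reflectionSplit k hp).gen = 0) (h : Equiv.Perm (Fin p)) :
    f * (reflectionSplit k hp).sym * MonoidAlgebra.single h 1 =
      f * (reflectionSplit k hp).sym := by
  have h1 := (quotient_asAlgebraHom_mk k f (Pi.single (firstLetter hp) 1)).symm.trans hf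
  rw [Submodule.Quotient.mk_eq_zero] at h1
  change f * stabilizerSum k hp * _ = f * stabilizerSum k hp
  rw [mul_stabilizerSum, Finset.sum_mul]
  refine Fintype.sum_equiv (Equiv.mulRight h) _ _ fun w => ?_
  rw [MonoidAlgebra.single_mul_single, mul_one, Equiv.coe_mulRight,
    h1 (w (firstLetter hp)) ((w * h) (firstLetter hp))]

end LocalFactors

/-! ### Lacunar sets and non-shadows -/

section Lacunar

/-- A lacunar set `I` has the least sum among the sets of positive integers which meet every pair
`{c, c + 1}` with `c ∈ I`, and it is the only one of these with that sum. -/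
theorem IsLacunar.eq_of_sum_le {I J : Finset ℕ} (hI : IsLacunar I) (hJ : 0 ∉ J)
    (h : ∀ c ∈ I, c ∈ J ∨ c + 1 ∈ J) (hs : ∑ x ∈ J, x ≤ ∑ x ∈ I, x) : I = J := by
  classical
  -- `φ` maps `I` injectively into `J`, without decreasing any element
  let φ : ℕ → ℕ := fun c => if c ∈ J then c else c + 1
  have hφ : ∀ c, c ≤ φ c := fun c => by simp only [φ]; split_ifs <;> omega
  have hinj : Set.InjOn φ I := by
    intro c hc c' hc' e
    have h1 := hI c hc
    have h2 := hI c' hc'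
    simp only [φ] at e
    split_ifs at e
    · exact e
    · exact absurd (e ▸ hc) h2
    · exact absurd (e ▸ hc') h1
    · omega
  have himg : I.image φ ⊆ J := by
    intro x hx
    obtain ⟨c, hc, rfl⟩ := Finset.mem_image.mp hx
    simp only [φ]
    split_ifs with hcJ
    · exact hcJ
    · exact (h c hc).resolve_left hcJ
  have h1 : ∑ x ∈ I, x ≤ ∑ x ∈ I, φ x := Finset.sum_le_sum fun c _ => hφ c
  have h2 : ∑ x ∈ I.image φ, x = ∑ x ∈ I, φ x := Finset.sum_image hinj
  have h3 : ∑ x ∈ J \ I.image φ, x + ∑ x ∈ I.image φ, x = ∑ x ∈ J, x := Finset.sum_sdiff himg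
  have h4 : ∀ c ∈ I, c = φ c :=
    (Finset.sum_eq_sum_iff_of_le fun c _ => hφ c).mp (by omega)
  have h5 : I.image φ = I := by
    rw [Finset.image_congr (g := id) fun c hc => (h4 c hc).symm, Finset.image_id]
  rw [h5] at himg h3
  refine himg.antisymm fun x hx => ?_
  by_contra hxI
  have h6 : ∑ x ∈ J \ I, x = 0 := by omega
  have := Finset.sum_eq_zero_iff.mp h6 x (Finset.mem_sdiff.mpr ⟨hx, hxI⟩)
  exact hJ (this ▸ hx)

theorem mem_nonShadow {n : ℕ} {I : Finset ℕ} {i : ℕ} :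
    i ∈ nonShadow n I ↔ (1 ≤ i ∧ i ≤ n - 1) ∧ i ∉ I ∧ i + 1 ∉ I := by
  simp [nonShadow]

/-- The set obtained from a set `I` of positive integers by replacing `c` with `c - 1`, which is
dropped if it is `0`. -/
def lowerAt (I : Finset ℕ) (c : ℕ) : Finset ℕ := (insert (c - 1) (I.erase c)).erase 0

theorem lowerAt_subset {n : ℕ} {I : Finset ℕ} (hI : I ⊆ Finset.Icc 1 (n - 1)) {c : ℕ}
    (hc : c ∈ I) : lowerAt I c ⊆ Finset.Icc 1 (n - 1) := by
  intro x hx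
  simp only [lowerAt, Finset.mem_erase, Finset.mem_insert] at hx
  have h1 := Finset.mem_Icc.mp (hI hc)
  rcases hx.2 with rfl | h
  · rw [Finset.mem_Icc]; omega
  · exact hI h.2

theorem sum_lowerAt_lt {n : ℕ} {I : Finset ℕ} (hI : I ⊆ Finset.Icc 1 (n - 1)) {c : ℕ}
    (hc : c ∈ I) : ∑ x ∈ lowerAt I c, x < ∑ x ∈ I, x := by
  have h1 := Finset.mem_Icc.mp (hI hc)
  have h2 : ∑ x ∈ lowerAt I c, x ≤ ∑ x ∈ insert (c - 1) (I.erase c), x :=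
    Finset.sum_le_sum_of_subset (Finset.erase_subset _ _)
  have h3 := Finset.add_sum_erase I (fun x => x) hc
  have h4 : ∑ x ∈ insert (c - 1) (I.erase c), x ≤ c - 1 + ∑ x ∈ I.erase c, x := by
    by_cases h : c - 1 ∈ I.erase c
    · rw [Finset.insert_eq_of_mem h]; omega
    · rw [Finset.sum_insert h]
  omega

theorem mem_nonShadow_of_lowerAt {n : ℕ} {I : Finset ℕ} {c i : ℕ}
    (hi : i ∈ nonShadow n (lowerAt I c)) (hic : i ≠ c) : i ∈ nonShadow n I := by
  rw [mem_nonShadow] at hi ⊢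
  simp only [lowerAt, Finset.mem_erase, Finset.mem_insert] at hi
  refine ⟨hi.1, fun h => hi.2.1 ⟨by omega, Or.inr ⟨hic, h⟩⟩, fun h => ?_⟩
  by_cases hc : i + 1 = c
  · exact hi.2.1 ⟨by omega, Or.inl (by omega)⟩
  · exact hi.2.2 ⟨by omega, Or.inr ⟨hc, h⟩⟩

/-- Lowering one of two consecutive elements repeatedly produces a lacunar set without enlarging
the sum or the non-shadow. -/
theorem exists_isLacunar_nonShadow_subset {n : ℕ} (I : Finset ℕ) (hI : I ⊆ Finset.Icc 1 (n - 1)) :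
    ∃ J ⊆ Finset.Icc 1 (n - 1), IsLacunar J ∧ ∑ x ∈ J, x ≤ ∑ x ∈ I, x ∧
      nonShadow n J ⊆ nonShadow n I := by
  induction hs : ∑ x ∈ I, x using Nat.strong_induction_on generalizing I with
  | _ s ih =>
    subst hs
    by_cases hlac : IsLacunar I
    · exact ⟨I, hI, hlac, le_rfl, subset_rfl⟩
    · simp only [IsLacunar, not_forall, not_not] at hlac
      obtain ⟨c, hc, hc'⟩ := hlac
      have hlt := sum_lowerAt_lt hI hc
      obtain ⟨J, hJ, hJl, hJs, hJn⟩ := ih _ hlt _ (lowerAt_subset hI hc) rfl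
      refine ⟨J, hJ, hJl, hJs.trans hlt.le, fun i hi => ?_⟩
      refine mem_nonShadow_of_lowerAt (hJn hi) ?_
      rintro rfl
      refine (mem_nonShadow.mp (hJn hi)).2.2 ?_
      simp [lowerAt, hc']

theorem lacunarIdeal_mono (k : Type u) [CommRing k] {n : ℕ} {I J : Finset ℕ}
    (h : nonShadow n J ⊆ nonShadow n I) : lacunarIdeal k n I ≤ lacunarIdeal k n J :=
  fun _ hq i h₁ h₂ hi => hq i h₁ h₂ (h hi)

theorem filtrationTerm_succ (k : Type u) [CommRing k] (n : ℕ) {N : ℕ} (Q : Fin N → Finset ℕ)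
    (i : Fin N) : filtrationTerm k n Q (i.val + 1) =
      filtrationTerm k n Q i.val ⊔ lacunarIdeal k n (Q i) := by
  apply le_antisymm
  · refine iSup₂_le fun s hs => ?_
    rcases Nat.lt_succ_iff_lt_or_eq.mp hs with h | h
    · exact le_sup_of_le_left (le_iSup₂_of_le s h le_rfl)
    · exact le_sup_of_le_right (by rw [Fin.ext h])
  · refine sup_le (iSup₂_le fun s hs => ?_) ?_
    · exact le_iSup₂_of_le s (hs.trans (Nat.lt_succ_self _)) le_rfl
    · exact le_iSup₂_of_le i (Nat.lt_succ_self _) le_rfl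

end Lacunar

/-! ### Invariants and subgroup sums -/

section SubgroupSum

variable (k : Type u) [CommRing k] {S : Type} [Group S]

/-- Right invariants under a finite subgroup are the left multiples of its sum. -/
theorem mem_span_sum_of_invariant [Fintype S] (W : Subgroup S) [Fintype W] (q : MonoidAlgebra k S)
    (hq : ∀ w ∈ W, q * MonoidAlgebra.single w 1 = q) :
    q ∈ Submodule.span (MonoidAlgebra k S) {∑ w : W, MonoidAlgebra.single (w : S) (1 : k)} := by
  classical
  have hc : ∀ g, ∀ w ∈ W, q.coeff (g * w) = q.coeff g := by
    intro g w hw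
    conv_lhs => rw [← hq w hw]
    simp
  rw [Submodule.mem_span_singleton]
  refine ⟨∑ c : S ⧸ W, MonoidAlgebra.single c.out (q.coeff c.out), ?_⟩
  have h1 : q = ∑ g, MonoidAlgebra.single g (q.coeff g) := by
    ext g
    rw [coeff_sum_single]
  conv_rhs => rw [h1]
  rw [smul_eq_mul, Finset.sum_mul_sum, ← Finset.sum_product', Finset.univ_product_univ]
  refine Fintype.sum_bijective (fun x : (S ⧸ W) × W => x.1.out * (x.2 : S)) ⟨?_, ?_⟩ _ _ ?_
  · rintro ⟨c, w⟩ ⟨c', w'⟩ h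
    have h2 : c = c' := by
      have := congrArg (QuotientGroup.mk (s := W)) h
      simpa using this
    subst h2
    simpa using h
  · intro g
    obtain ⟨w, hw⟩ := QuotientGroup.mk_out_eq_mul W g
    exact ⟨⟨g, w⁻¹⟩, by simp [hw]⟩
  · rintro ⟨c, w⟩
    rw [MonoidAlgebra.single_mul_single, mul_one, hc _ _ w.2]

/-- Right invariance of one factor passes to the product. -/
theorem groupAlgebraProd_mul_single {m : ℕ} {G : Fin m → Type} [∀ l, Group (G l)]
    [∀ l, Fintype (G l)] (e : (∀ l, G l) →* S) (f : ∀ l, MonoidAlgebra k (G l)) (l : Fin m)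
    (h : G l) (hf : f l * MonoidAlgebra.single h 1 = f l) :
    groupAlgebraProd k e f * MonoidAlgebra.single (e (Pi.mulSingle l h)) 1 =
      groupAlgebraProd k e f := by
  rw [← groupAlgebraProd_single, ← groupAlgebraProd_mul]
  congr 1
  ext1 l'
  rcases eq_or_ne l' l with rfl | hl
  · rw [Pi.mulSingle_eq_same, hf]
  · rw [Pi.mulSingle_eq_of_ne hl, ← MonoidAlgebra.one_def, mul_one]

/-- A product with a factor `1 - h` is killed by all elements which are right invariant under
`h`. -/
theorem mul_groupAlgebraProd_eq_zero {m : ℕ} {G : Fin m → Type} [∀ l, Group (G l)]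
    [∀ l, Fintype (G l)] (e : (∀ l, G l) →* S) (f : ∀ l, MonoidAlgebra k (G l)) (l : Fin m)
    (h : G l) (hf : f l = 1 - MonoidAlgebra.single h 1) (q : MonoidAlgebra k S)
    (hq : q * MonoidAlgebra.single (e (Pi.mulSingle l h)) 1 = q) :
    q * groupAlgebraProd k e f = 0 := by
  have h2 : groupAlgebraProd k e f = groupAlgebraProd k e (Function.update f l 1) -
      MonoidAlgebra.single (e (Pi.mulSingle l h)) 1 *
        groupAlgebraProd k e (Function.update f l 1) := by
    conv_lhs => rw [← Function.update_eq_self l f, hf, MultilinearMap.map_update_sub]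
    congr 1
    rw [← groupAlgebraProd_single, ← groupAlgebraProd_mul]
    congr 1
    ext1 l'
    rcases eq_or_ne l' l with rfl | hl
    · simp
    · simp [hl, ← MonoidAlgebra.one_def]
  rw [h2, mul_sub, ← mul_assoc, hq, sub_self]

end SubgroupSum

/-! ### The parabolic embedding and its blocks -/

section Blocks

variable {m n : ℕ} (j : Fin m → ℕ) (h : ∑ l, j l = n)

/-- The letter at position `x` of the `l`-th of the consecutive blocks of lengths `j`. -/
def blockLetter (l : Fin m) (x : Fin (j l)) : Fin n := finCongr h (finSigmaFinEquiv ⟨l, x⟩)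

theorem exists_blockLetter (z : Fin n) : ∃ l x, z = blockLetter j h l x := by
  obtain ⟨⟨l, x⟩, hx⟩ := (finSigmaFinEquiv.trans (finCongr h)).surjective z
  exact ⟨l, x, hx.symm⟩

theorem parabolicEmbedding_blockLetter (y : ∀ l, Equiv.Perm (Fin (j l))) (l : Fin m)
    (x : Fin (j l)) :
    parabolicEmbedding j h y (blockLetter j h l x) = blockLetter j h l (y l x) := by
  simp [parabolicEmbedding, blockLetter, Equiv.permCongrHom, Equiv.permCongr_apply]

theorem blockLetter_injective (l : Fin m) : Function.Injective (blockLetter j h l) := by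
  intro x x' hx
  simpa [blockLetter] using hx

theorem blockLetter_ne {l l' : Fin m} (hl : l ≠ l') (x : Fin (j l)) (x' : Fin (j l')) :
    blockLetter j h l x ≠ blockLetter j h l' x' := by
  intro hx
  have : (⟨l, x⟩ : (l : Fin m) × Fin (j l)) = ⟨l', x'⟩ := by
    simpa [blockLetter] using hx
  exact hl (congrArg Sigma.fst this)

theorem parabolicEmbedding_injective : Function.Injective (parabolicEmbedding j h) := by
  intro y y' hy
  ext l x
  have := congrArg (fun σ : Equiv.Perm (Fin n) => σ (blockLetter j h l x)) hy
  simp only [parabolicEmbedding_blockLetter] at this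
  rw [blockLetter_injective j h l this]

theorem parabolicEmbedding_mulSingle_swap (l : Fin m) (x x' : Fin (j l)) :
    parabolicEmbedding j h (Pi.mulSingle l (Equiv.swap x x')) =
      Equiv.swap (blockLetter j h l x) (blockLetter j h l x') := by
  ext1 z
  obtain ⟨l', z, rfl⟩ := exists_blockLetter j h z
  rw [parabolicEmbedding_blockLetter]
  rcases eq_or_ne l' l with rfl | hl
  · rw [Pi.mulSingle_eq_same, (blockLetter_injective j h l').swap_apply]
  · rw [Pi.mulSingle_eq_of_ne hl, Equiv.Perm.one_apply, Equiv.swap_apply_of_ne_of_ne]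
    · exact blockLetter_ne j h hl _ _
    · exact blockLetter_ne j h hl _ _

/-- The permutations of the `l`-th block which fix its first letter unless `l = 0`. -/
def blockStabilizer {m : ℕ} (j : Fin (m + 1) → ℕ) (l : Fin (m + 1)) :
    Subgroup (Equiv.Perm (Fin (j l))) where
  carrier := {y | l ≠ 0 → ∀ x : Fin (j l), x.val = 0 → y x = x}
  one_mem' _ _ _ := rfl
  mul_mem' ha hb hl x hx := by
    rw [Equiv.Perm.mul_apply, hb hl x hx, ha hl x hx]
  inv_mem' ha hl x hx := by
    rw [Equiv.Perm.inv_eq_iff_eq, ha hl x hx]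

end Blocks

/-! ### The factors of the induction product -/

section Factors

variable (k : Type u) [CommRing k] {m : ℕ} (j : Fin (m + 1) → ℕ) (hj : ∀ l : Fin m, 1 < j l.succ)

/-- The presentations of the factors `H_{j_1}, Z_{j_2}, …, Z_{j_m}`. -/
noncomputable def factorSplit : ∀ l, SplitCyclic (fibonacciFactors k j l).ρ :=
  Fin.cases (trivialSplit k (Equiv.Perm (Fin (j 0)))) fun l => reflectionSplit k (hj l)

theorem factorSplit_sym (l : Fin (m + 1)) (c : Equiv.Perm (Fin (j l)))
    [Decidable (c ∈ blockStabilizer j l)] :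
    (factorSplit k j hj l).sym.coeff c = if c ∈ blockStabilizer j l then 1 else 0 := by
  induction l using Fin.cases with
  | zero =>
    have h1 : c ∈ blockStabilizer j 0 := fun h => absurd rfl h
    rw [if_pos h1]
    exact coeff_sum_single k (fun _ => 1) c
  | succ l =>
    have h1 : c ∈ blockStabilizer j l.succ ↔ c (firstLetter (hj l)) = firstLetter (hj l) := by
      constructor
      · intro hc
        exact hc (Fin.succ_ne_zero l) _ rfl
      · intro hc _ x hx
        have : x = firstLetter (hj l) := Fin.ext hx
        rw [this, hc]
    simp only [h1]
    change (stabilizerSum k (hj l)).coeff c = _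
    rw [stabilizerSum, Finset.sum_filter]
    have := coeff_sum_single k (fun w : Equiv.Perm (Fin (j l.succ)) =>
      if w (firstLetter (hj l)) = firstLetter (hj l) then (1 : k) else 0) c
    rw [← this]
    congr 1
    refine congrArg _ (Finset.sum_congr rfl fun w _ => ?_)
    split_ifs <;> simp

theorem factorSplit_sym_mul_single (l : Fin (m + 1)) (c : Equiv.Perm (Fin (j l)))
    (hc : c ∈ blockStabilizer j l) :
    (factorSplit k j hj l).sym * MonoidAlgebra.single c 1 = (factorSplit k j hj l).sym := by
  classical
  ext w
  rw [factorSplit_sym, MonoidAlgebra.coeff_mul_single_apply, factorSplit_sym, mul_one]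
  simp only [Subgroup.mul_mem_cancel_right _ (inv_mem hc)]

/-- The product of the elements `sym` is the sum of the Young subgroup given by the block
stabilizers. -/
theorem groupAlgebraProd_factorSplit_sym {n : ℕ} (h : ∑ l, j l = n)
    (W : Subgroup (Equiv.Perm (Fin n))) [Fintype W]
    (hW : W = (Subgroup.pi Set.univ (blockStabilizer j)).map (parabolicEmbedding j h)) :
    groupAlgebraProd k (parabolicEmbedding j h) (fun l => (factorSplit k j hj l).sym) =
      ∑ w : W, MonoidAlgebra.single (w : Equiv.Perm (Fin n)) (1 : k) := by
  classical
  rw [groupAlgebraProd_apply]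
  simp only [factorSplit_sym, Finset.prod_ite_zero, Finset.prod_const_one]
  have h1 : ∀ y : ∀ l, Equiv.Perm (Fin (j l)), MonoidAlgebra.single (parabolicEmbedding j h y)
      (if ∀ l ∈ Finset.univ, y l ∈ blockStabilizer j l then (1 : k) else 0) =
      if ∀ l, y l ∈ blockStabilizer j l then
        MonoidAlgebra.single (parabolicEmbedding j h y) (1 : k) else 0 := by
    intro y
    split_ifs <;> simp_all
  rw [Finset.sum_congr rfl fun y _ => h1 y, ← Finset.sum_filter]
  refine Finset.sum_bij (fun y hy => ⟨parabolicEmbedding j h y, ?_⟩) (fun _ _ => Finset.mem_univ _)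
    ?_ ?_ (fun _ _ => rfl)
  · rw [hW]
    refine ⟨y, fun l _ => ?_, rfl⟩
    exact (Finset.mem_filter.mp hy).2 l
  · intro y _ y' _ hy
    exact parabolicEmbedding_injective j h (congrArg Subtype.val hy)
  · rintro ⟨w, hw⟩ _
    rw [hW] at hw
    obtain ⟨y, hy, rfl⟩ := hw
    exact ⟨y, Finset.mem_filter.mpr ⟨Finset.mem_univ _, fun l => hy l trivial⟩, rfl⟩

end Factors

/-! ### Blocks cut out by a strictly increasing sequence -/

section Gaps

variable {m : ℕ} {a : Fin (m + 1) → ℕ}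

/-- One plus the total length of the blocks before the `l`-th one is where that block starts. -/
theorem one_add_sum_gaps (ha : StrictMono a) (ha0 : 1 ≤ a 0) (l : ℕ) (hl : l ≤ m + 1) :
    1 + ∑ i : Fin l, gaps a (Fin.castLE hl i) =
      (Fin.cons 1 a : Fin (m + 2) → ℕ) ⟨l, by omega⟩ := by
  have hmono : ∀ i : Fin (m + 1), (Fin.cons 1 a : Fin (m + 2) → ℕ) i.castSucc ≤
      (Fin.cons 1 a : Fin (m + 2) → ℕ) i.succ := by
    intro i
    induction i using Fin.cases with
    | zero => simpa using ha0
    | succ i =>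
      rw [← Fin.succ_castSucc, Fin.cons_succ, Fin.cons_succ]
      exact (ha Fin.castSucc_lt_succ).le
  induction l with
  | zero => simp
  | succ l ih =>
    rw [Fin.sum_univ_castSucc, ← add_assoc]
    have h1 := ih (by omega)
    have h2 : ∀ i : Fin l, Fin.castLE hl i.castSucc = Fin.castLE (by omega) i := fun i => rfl
    simp only [h2]
    rw [h1]
    have h3 := hmono ⟨l, by omega⟩
    have h4 : Fin.castLE hl (Fin.last l) = ⟨l, by omega⟩ := rfl
    rw [h4, gaps]
    exact Nat.add_sub_of_le h3

theorem sum_gaps (ha : StrictMono a) (ha0 : 1 ≤ a 0) {n : ℕ} (hn : a (Fin.last m) = n + 1) :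
    ∑ l, gaps a l = n := by
  have h1 := one_add_sum_gaps ha ha0 (m + 1) le_rfl
  have h2 : (⟨m + 1, by omega⟩ : Fin (m + 2)) = (Fin.last m).succ := rfl
  rw [h2, Fin.cons_succ, hn] at h1
  simp only [Fin.castLE_rfl, id] at h1
  omega

theorem blockLetter_val (ha : StrictMono a) (ha0 : 1 ≤ a 0) {n : ℕ} (h : ∑ l, gaps a l = n)
    (l : Fin (m + 1)) (x : Fin (gaps a l)) :
    (blockLetter (gaps a) h l x).val + 1 =
      (Fin.cons 1 a : Fin (m + 2) → ℕ) l.castSucc + x.val := by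
  have h1 := one_add_sum_gaps ha ha0 l.val l.2.le
  have h2 : (⟨l.val, by omega⟩ : Fin (m + 2)) = l.castSucc := rfl
  rw [h2] at h1
  rw [← h1, blockLetter, finCongr_apply_coe, finSigmaFinEquiv_apply]
  simp only
  omega

/-- No element of `a` lies in the interior of a block: not at its first letter either if it is the
block `0`, which starts at `1` and not at an element of `a`. -/
theorem not_between (ha : StrictMono a) (l : Fin (m + 1)) (x : ℕ) (hx : x < gaps a l)
    (hl : l ≠ 0 → x ≠ 0) (t : Fin (m + 1)) :
    a t ≠ (Fin.cons 1 a : Fin (m + 2) → ℕ) l.castSucc + x := by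
  intro ht
  have h1 : a t < a l := by
    simp only [gaps, Fin.cons_succ] at hx
    omega
  have h2 := ha.lt_iff_lt.mp h1
  induction l using Fin.cases with
  | zero => exact absurd h2 (Fin.not_lt_zero t)
  | succ l =>
    rw [← Fin.succ_castSucc, Fin.cons_succ] at ht
    have h3 : t ≤ l.castSucc := Fin.le_castSucc_iff.mpr h2
    have h4 := ha.monotone h3
    have := hl (Fin.succ_ne_zero l)
    omega

end Gaps

/-! ### The Young subgroup of a lacunar set -/

section YoungSubgroup

variable {m n : ℕ} {a : Fin (m + 1) → ℕ} {I : Finset ℕ}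

theorem last_eq_of_range (ha : StrictMono a) (hI : I ⊆ Finset.Icc 1 (n - 1))
    (haI : Set.range a = (↑(insert (n + 1) I) : Set ℕ)) : a (Fin.last m) = n + 1 := by
  have h1 : ∀ t, a t = n + 1 ∨ a t ∈ I := fun t => by
    have : a t ∈ (↑(insert (n + 1) I) : Set ℕ) := haI ▸ Set.mem_range_self t
    simpa using this
  obtain ⟨t, ht⟩ : n + 1 ∈ Set.range a := by simp [haI]
  have h2 := ha.monotone (Fin.le_last t)
  rcases h1 (Fin.last m) with h | h
  · exact h
  · have := Finset.mem_Icc.mp (hI h)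
    omega

theorem castSucc_mem_of_range (ha : StrictMono a) (hI : I ⊆ Finset.Icc 1 (n - 1))
    (haI : Set.range a = (↑(insert (n + 1) I) : Set ℕ)) (t : Fin m) : a t.castSucc ∈ I := by
  have h1 : a t.castSucc ∈ (↑(insert (n + 1) I) : Set ℕ) := haI ▸ Set.mem_range_self _
  have h2 := ha (Fin.castSucc_lt_last t)
  rw [last_eq_of_range ha hI haI] at h2
  simp only [Finset.coe_insert, Set.mem_insert_iff, Finset.mem_coe] at h1
  exact h1.resolve_left (by omega)

theorem exists_castSucc_of_mem (ha : StrictMono a) (hI : I ⊆ Finset.Icc 1 (n - 1))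
    (haI : Set.range a = (↑(insert (n + 1) I) : Set ℕ)) {c : ℕ} (hc : c ∈ I) :
    ∃ t : Fin m, a t.castSucc = c := by
  obtain ⟨t, rfl⟩ : c ∈ Set.range a := by simp [haI, hc]
  have h1 := Finset.mem_Icc.mp (hI hc)
  have h2 : t ≠ Fin.last m := by
    rintro rfl
    rw [last_eq_of_range ha hI haI] at h1
    omega
  exact ⟨t.castPred h2, by simp⟩

theorem one_le_zero_of_range (hI : I ⊆ Finset.Icc 1 (n - 1))
    (haI : Set.range a = (↑(insert (n + 1) I) : Set ℕ)) : 1 ≤ a 0 := by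
  have h1 : a 0 ∈ (↑(insert (n + 1) I) : Set ℕ) := haI ▸ Set.mem_range_self _
  simp only [Finset.coe_insert, Set.mem_insert_iff, Finset.mem_coe] at h1
  rcases h1 with h | h
  · omega
  · exact (Finset.mem_Icc.mp (hI h)).1

theorem one_lt_gaps_succ (ha : StrictMono a) (hI : I ⊆ Finset.Icc 1 (n - 1)) (hIl : IsLacunar I)
    (haI : Set.range a = (↑(insert (n + 1) I) : Set ℕ)) (l : Fin m) : 1 < gaps a l.succ := by
  have h1 := castSucc_mem_of_range ha hI haI l
  have h2 : a l.succ ∈ (↑(insert (n + 1) I) : Set ℕ) := haI ▸ Set.mem_range_self _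
  have h3 : a l.castSucc < a l.succ := ha Fin.castSucc_lt_succ
  have h4 : gaps a l.succ = a l.succ - a l.castSucc := by
    simp only [gaps, ← Fin.succ_castSucc, Fin.cons_succ]
  have h5 := Finset.mem_Icc.mp (hI h1)
  have h6 : a l.succ ≠ a l.castSucc + 1 := by
    intro h
    simp only [Finset.coe_insert, Set.mem_insert_iff, Finset.mem_coe] at h2
    rcases h2 with h2 | h2
    · omega
    · exact hIl _ h1 (h ▸ h2)
  omega

variable (ha : StrictMono a) (hI : I ⊆ Finset.Icc 1 (n - 1))
  (haI : Set.range a = (↑(insert (n + 1) I) : Set ℕ)) (h : ∑ l, gaps a l = n)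

include ha hI haI

/-- The simple transposition of two adjacent letters of a block. -/
theorem swap_blockLetter_eq (l : Fin (m + 1)) (x x' : Fin (gaps a l)) (hx : x'.val = x.val + 1)
    (i : ℕ) (hi : (Fin.cons 1 a : Fin (m + 2) → ℕ) l.castSucc + x.val = i) :
    ∃ (h₁ : 1 ≤ i) (h₂ : i < n), Equiv.swap (blockLetter (gaps a) h l x)
      (blockLetter (gaps a) h l x') = simpleTransposition n i h₁ h₂ := by
  have ha0 := one_le_zero_of_range hI haI
  have h1 := blockLetter_val ha ha0 h l x
  have h2 := blockLetter_val ha ha0 h l x'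
  have h3 := (blockLetter (gaps a) h l x').2
  refine ⟨by omega, by omega, ?_⟩
  rw [simpleTransposition]
  congr 1 <;> exact Fin.ext (by simp only; omega)

include h in
/-- Two adjacent letters of a block give an element of the non-shadow, unless the first one starts a
block other than the block `0`. -/
theorem add_mem_nonShadow (l : Fin (m + 1)) (x x' : Fin (gaps a l)) (hx : x'.val = x.val + 1)
    (hl : l ≠ 0 → x.val ≠ 0) :
    (Fin.cons 1 a : Fin (m + 2) → ℕ) l.castSucc + x.val ∈ nonShadow n I := by
  have ha0 := one_le_zero_of_range hI haI
  obtain ⟨h₁, h₂, -⟩ := swap_blockLetter_eq ha hI haI h l x x' hx _ rfl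
  rw [mem_nonShadow]
  refine ⟨⟨h₁, by omega⟩, fun hc => ?_, fun hc => ?_⟩
  · obtain ⟨t, ht⟩ := exists_castSucc_of_mem ha hI haI hc
    exact not_between ha l x.val x.2 hl _ ht
  · obtain ⟨t, ht⟩ := exists_castSucc_of_mem ha hI haI hc
    refine not_between ha l x'.val x'.2 (fun _ => by omega) _ (ht.trans ?_)
    omega

/-- The simple transpositions indexed by the non-shadow lie in the Young subgroup given by the
block stabilizers. -/
theorem exists_mulSingle_of_mem_nonShadow (i : ℕ) (h₁ : 1 ≤ i) (h₂ : i < n)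
    (hi : i ∈ nonShadow n I) : ∃ l, ∃ y ∈ blockStabilizer (gaps a) l,
      parabolicEmbedding (gaps a) h (Pi.mulSingle l y) = simpleTransposition n i h₁ h₂ := by
  have ha0 := one_le_zero_of_range hI haI
  obtain ⟨l, x, hx⟩ := exists_blockLetter (gaps a) h ⟨i - 1, by omega⟩
  have hv := blockLetter_val ha ha0 h l x
  rw [← hx] at hv
  simp only at hv
  have hmem : ∀ t, a t = n + 1 ∨ a t ∈ I := fun t => by
    have : a t ∈ (↑(insert (n + 1) I) : Set ℕ) := haI ▸ Set.mem_range_self t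
    simpa using this
  rw [mem_nonShadow] at hi
  have hlt : x.val + 1 < gaps a l := by
    by_contra hge
    have h3 := x.2
    have h4 : gaps a l = a l - (Fin.cons 1 a : Fin (m + 2) → ℕ) l.castSucc := by
      rw [gaps, Fin.cons_succ]
    have h5 : a l = i + 1 := by omega
    rcases hmem l with h6 | h6
    · omega
    · exact hi.2.2 (h5 ▸ h6)
  have h0 : l ≠ 0 → x.val ≠ 0 := by
    intro hl hx0
    obtain ⟨l, rfl⟩ := Fin.exists_succ_eq_of_ne_zero hl
    rw [← Fin.succ_castSucc, Fin.cons_succ] at hv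
    have h5 : a l.castSucc = i := by omega
    exact hi.2.1 (h5 ▸ castSucc_mem_of_range ha hI haI l)
  refine ⟨l, Equiv.swap x ⟨x.val + 1, hlt⟩, fun hl z hz => ?_, ?_⟩
  · apply Equiv.swap_apply_of_ne_of_ne
    · rintro rfl
      exact h0 hl hz
    · rintro rfl
      simp at hz
  · rw [parabolicEmbedding_mulSingle_swap]
    obtain ⟨_, _, h6⟩ := swap_blockLetter_eq ha hI haI h l x ⟨x.val + 1, hlt⟩ rfl i (by omega)
    exact h6

/-- The simple transpositions indexed by the non-shadow generate the Young subgroup given by the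
block stabilizers. -/
theorem parabolicEmbedding_mem_closure (y : ∀ l, Equiv.Perm (Fin (gaps a l)))
    (hy : ∀ l, y l ∈ blockStabilizer (gaps a) l) :
    parabolicEmbedding (gaps a) h y ∈ Subgroup.closure
      {s | ∃ (i : ℕ) (h₁ : 1 ≤ i) (h₂ : i < n), i ∈ nonShadow n I ∧
        s = simpleTransposition n i h₁ h₂} := by
  set T : Set (Equiv.Perm (Fin n)) := {s | ∃ (i : ℕ) (h₁ : 1 ≤ i) (h₂ : i < n),
    i ∈ nonShadow n I ∧ s = simpleTransposition n i h₁ h₂}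
  have hT : ∀ s ∈ T, s.IsSwap := by
    rintro _ ⟨i, h₁, h₂, -, rfl⟩
    refine ⟨_, _, ?_, rfl⟩
    simp only [ne_eq, Fin.mk.injEq]
    omega
  -- two letters of a block other than its fixed first letter are joined by a chain of adjacent
  -- transpositions
  have horb : ∀ (d : ℕ) (l : Fin (m + 1)) (x x' : Fin (gaps a l)), x'.val = x.val + d →
      (l ≠ 0 → x.val ≠ 0) → blockLetter (gaps a) h l x' ∈
        MulAction.orbit (Subgroup.closure T) (blockLetter (gaps a) h l x) := by
    intro d
    induction d with
    | zero =>
      intro l x x' hx _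
      rw [Fin.ext hx]
      exact MulAction.mem_orbit_self _
    | succ d ih =>
      intro l x x' hx hl
      have h1 := ih l x ⟨x.val + d, by omega⟩ rfl hl
      refine (MulAction.orbit_eq_iff.mpr h1) ▸ ?_
      have hx' : x'.val = (⟨x.val + d, by omega⟩ : Fin (gaps a l)).val + 1 := hx
      have h2 := add_mem_nonShadow ha hI haI h l _ x' hx' (fun h0 => by
        have := hl h0
        simp only
        omega)
      obtain ⟨h₁, h₂, h3⟩ := swap_blockLetter_eq ha hI haI h l _ x' hx' _ rfl
      exact ⟨⟨_, Subgroup.subset_closure ⟨_, h₁, h₂, h2, h3⟩⟩, Equiv.swap_apply_left _ _⟩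
  rw [mem_closure_isSwap hT]
  refine ⟨Set.toFinite _, fun z => ?_⟩
  obtain ⟨l, x, rfl⟩ := exists_blockLetter (gaps a) h z
  rw [parabolicEmbedding_blockLetter]
  by_cases hlx : l ≠ 0 → x.val ≠ 0
  · have hlx' : l ≠ 0 → (y l x).val ≠ 0 := by
      intro hl h0
      have h1 := hy l hl _ h0
      have h2 := (y l).injective h1
      exact hlx hl (h2 ▸ h0)
    rcases le_total x.val (y l x).val with hle | hle
    · exact horb ((y l x).val - x.val) l _ _ (by omega) hlx
    · exact MulAction.mem_orbit_symm.mp (horb (x.val - (y l x).val) l _ _ (by omega) hlx')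
  · simp only [ne_eq, Classical.not_imp, not_not] at hlx
    rw [hy l hlx.1 x hlx.2]
    exact MulAction.mem_orbit_self _

/-- The transposition `s_c` for `c ∈ I` swaps the first two letters of the block starting at `c`. -/
theorem exists_swap_eq_simpleTransposition (t : Fin m) (hj : 1 < gaps a t.succ) :
    ∃ (h₁ : 1 ≤ a t.castSucc) (h₂ : a t.castSucc < n),
      parabolicEmbedding (gaps a) h
        (Pi.mulSingle t.succ (Equiv.swap (firstLetter hj) (secondLetter hj))) =
      simpleTransposition n (a t.castSucc) h₁ h₂ := by
  rw [parabolicEmbedding_mulSingle_swap]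
  refine swap_blockLetter_eq ha hI haI h t.succ _ _ rfl _ ?_
  rw [← Fin.succ_castSucc, Fin.cons_succ]
  rfl

/-- `F(I)` is generated by the sum of the Young subgroup of `I`. -/
theorem lacunarIdeal_eq_span (k : Type u) [CommRing k] (hj : ∀ l : Fin m, 1 < gaps a l.succ) :
    lacunarIdeal k n I = Submodule.span _ {groupAlgebraProd k (parabolicEmbedding (gaps a) h)
      fun l => (factorSplit k (gaps a) hj l).sym} := by
  classical
  apply le_antisymm
  · intro q hq
    rw [groupAlgebraProd_factorSplit_sym k (gaps a) hj h _ rfl]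
    refine mem_span_sum_of_invariant k _ q ?_
    rintro _ ⟨y, hy, rfl⟩
    have h1 := parabolicEmbedding_mem_closure ha hI haI h y fun l => hy l trivial
    generalize parabolicEmbedding (gaps a) h y = g at h1
    induction h1 using Subgroup.closure_induction with
    | mem s hs =>
      obtain ⟨i, h₁, h₂, hi, rfl⟩ := hs
      exact hq i h₁ h₂ hi
    | one => rw [← MonoidAlgebra.one_def, mul_one]
    | mul s s' _ _ hs hs' =>
      have : MonoidAlgebra.single (s * s') (1 : k) =
          MonoidAlgebra.single s 1 * MonoidAlgebra.single s' 1 := by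
        rw [MonoidAlgebra.single_mul_single, mul_one]
      rw [this, ← mul_assoc, hs, hs']
    | inv s _ hs =>
      conv_lhs => rw [← hs]
      rw [mul_assoc, MonoidAlgebra.single_mul_single, mul_inv_cancel, mul_one,
        ← MonoidAlgebra.one_def, mul_one]
  · rw [Submodule.span_singleton_le_iff_mem]
    intro i h₁ h₂ hi
    obtain ⟨l, y, hy, h1⟩ := exists_mulSingle_of_mem_nonShadow ha hI haI h i h₁ h₂ hi
    rw [← h1]
    exact groupAlgebraProd_mul_single k (parabolicEmbedding (gaps a) h)
      (fun l => (factorSplit k (gaps a) hj l).sym) l y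
      (factorSplit_sym_mul_single k (gaps a) hj l y hy)

/-- If some `f_l` kills the generator of the `l`-th representation, then the corresponding multiple
of the sum of the Young subgroup vanishes, for `l = 0`, or is moreover invariant under `s_c` for
the first letter `c` of the `l`-th block. -/
theorem groupAlgebraProd_mem_of_annihilates (k : Type u) [CommRing k]
    (hj : ∀ l : Fin m, 1 < gaps a l.succ)
    (N : Submodule (SymmetricGroupAlgebra k n) (SymmetricGroupAlgebra k n))
    (hN : ∀ c ∈ I, lacunarIdeal k n (lowerAt I c) ≤ N)
    (f : ∀ l, MonoidAlgebra k (Equiv.Perm (Fin (gaps a l)))) (l : Fin (m + 1))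
    (hf : (fibonacciFactors k (gaps a) l).ρ.asAlgebraHom (f l)
      (factorSplit k (gaps a) hj l).gen = 0) :
    groupAlgebraProd k (parabolicEmbedding (gaps a) h)
      (fun l => f l * (factorSplit k (gaps a) hj l).sym) ∈ N := by
  induction l using Fin.cases with
  | zero =>
    have h1 : f 0 * (factorSplit k (gaps a) hj 0).sym = 0 := trivialSplit_mul_sym k (f 0) hf
    rw [MultilinearMap.map_coord_zero _ 0 h1]
    exact N.zero_mem
  | succ t =>
    refine hN _ (castSucc_mem_of_range ha hI haI t) ?_
    intro i h₁ h₂ hi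
    by_cases hic : i = a t.castSucc
    · subst hic
      obtain ⟨_, _, h1⟩ := exists_swap_eq_simpleTransposition ha hI haI h t (hj t)
      rw [← h1]
      exact groupAlgebraProd_mul_single k (parabolicEmbedding (gaps a) h)
        (fun l => f l * (factorSplit k (gaps a) hj l).sym) t.succ _
        (reflectionSplit_mul_sym k (hj t) _ hf _)
    · obtain ⟨l, y, hy, h1⟩ := exists_mulSingle_of_mem_nonShadow ha hI haI h i h₁ h₂
        (mem_nonShadow_of_lowerAt hi hic)
      rw [← h1]
      refine groupAlgebraProd_mul_single k (parabolicEmbedding (gaps a) h)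
        (fun l => f l * (factorSplit k (gaps a) hj l).sym) l y ?_
      rw [mul_assoc, factorSplit_sym_mul_single k (gaps a) hj l y hy]

/-- `F(J)` is killed by `∏_{c ∈ I} (1 - s_c)` if `I` meets the non-shadow of `J`. -/
theorem mul_groupAlgebraProd_alt_eq_zero (k : Type u) [CommRing k]
    (hj : ∀ l : Fin m, 1 < gaps a l.succ) {J : Finset ℕ} {c : ℕ} (hc : c ∈ I)
    (hcJ : c ∈ nonShadow n J) {q : SymmetricGroupAlgebra k n} (hq : q ∈ lacunarIdeal k n J) :
    q * groupAlgebraProd k (parabolicEmbedding (gaps a) h)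
      (fun l => (factorSplit k (gaps a) hj l).alt) = 0 := by
  obtain ⟨t, rfl⟩ := exists_castSucc_of_mem ha hI haI hc
  obtain ⟨h₁, h₂, h1⟩ := exists_swap_eq_simpleTransposition ha hI haI h t (hj t)
  refine mul_groupAlgebraProd_eq_zero k _ _ t.succ _ rfl q ?_
  rw [h1]
  exact hq _ h₁ h₂ hcJ

end YoungSubgroup

/-! ### The subquotients of the filtration -/

theorem mainTheorem2 (k : Type u) [CommRing k] (n : ℕ)
    -- a list of all lacunar subsets of `{1, …, n - 1}` without repetition, by increasing sum
    (Q : Fin (Nat.fib (n + 1)) → Finset ℕ)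
    (hQinj : Function.Injective Q)
    (hQ : ∀ I : Finset ℕ, (∃ s, Q s = I) ↔ I ⊆ Finset.Icc 1 (n - 1) ∧ IsLacunar I)
    (hQsum : ∀ s t, s ≤ t → ∑ x ∈ Q s, x ≤ ∑ x ∈ Q t, x)
    (i : Fin (Nat.fib (n + 1)))
    -- the elements of `Q_i ∪ {n + 1}` in increasing order
    (m : ℕ) (a : Fin (m + 1) → ℕ) (ha : StrictMono a)
    (haQ : Set.range a = (↑(insert (n + 1) (Q i)) : Set ℕ)) :
    1 ≤ a 0 ∧ (∀ l : Fin m, 1 < gaps a l.succ) ∧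
    ∃ h : ∑ l, gaps a l = n,
      Nonempty
        ((↥(filtrationTerm k n Q (i.val + 1)) ⧸
            (filtrationTerm k n Q i.val).submoduleOf (filtrationTerm k n Q (i.val + 1)))
          ≃ₗ[SymmetricGroupAlgebra k n]
          (inductionProduct (gaps a) h (fibonacciFactors k (gaps a))).asModule) := by
  have hsub : ∀ s, Q s ⊆ Finset.Icc 1 (n - 1) := fun s => ((hQ (Q s)).mp ⟨s, rfl⟩).1
  have hlac : ∀ s, IsLacunar (Q s) := fun s => ((hQ (Q s)).mp ⟨s, rfl⟩).2
  have ha0 := one_le_zero_of_range (hsub i) haQ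
  have hj := one_lt_gaps_succ ha (hsub i) (hlac i) haQ
  have h := sum_gaps ha ha0 (last_eq_of_range ha (hsub i) haQ)
  refine ⟨ha0, hj, h, ?_⟩
  refine SplitCyclic.nonempty_linearEquiv_ind (parabolicEmbedding (gaps a) h)
    (parabolicEmbedding_injective (gaps a) h) (factorSplit k (gaps a) hj) _ _ ?_ ?_ ?_
  · rw [filtrationTerm_succ, lacunarIdeal_eq_span ha (hsub i) haQ h k hj]
  · -- the terms `F(Q_s)` with `s < i` are killed by the factor `1 - s_c` for some `c ∈ Q_i`
    have hle : filtrationTerm k n Q i.val ≤ LinearMap.ker (LinearMap.toSpanSingleton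
        (SymmetricGroupAlgebra k n) _ (groupAlgebraProd k (parabolicEmbedding (gaps a) h)
          fun l => (factorSplit k (gaps a) hj l).alt)) := by
      refine iSup₂_le fun s hs q hq => ?_
      rw [LinearMap.mem_ker, LinearMap.toSpanSingleton_apply, smul_eq_mul]
      obtain ⟨c, hc, hcs⟩ : ∃ c ∈ Q i, c ∈ nonShadow n (Q s) := by
        by_contra! hcon
        have h1 : Q i = Q s := by
          refine (hlac i).eq_of_sum_le ?_ (fun c hc => ?_) (hQsum s i (Fin.le_of_lt hs))
          · intro h0
            have := Finset.mem_Icc.mp (hsub s h0)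
            omega
          · have h2 := hcon c hc
            rw [mem_nonShadow] at h2
            have h3 := Finset.mem_Icc.mp (hsub i hc)
            tauto
        have h2 := hQinj h1
        subst h2
        exact lt_irrefl _ hs
      exact mul_groupAlgebraProd_alt_eq_zero ha (hsub i) haQ h k hj hc hcs hq
    intro q hq
    simpa using hle hq
  · -- lowering some `c ∈ Q_i` leads to a lacunar set of smaller sum, that is, to `Q_s` with `s < i`
    intro f l hf
    refine groupAlgebraProd_mem_of_annihilates ha (hsub i) haQ h k hj _ (fun c hc => ?_) f l hf
    obtain ⟨J, hJ, hJl, hJs, hJn⟩ :=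
      exists_isLacunar_nonShadow_subset (lowerAt (Q i) c) (lowerAt_subset (hsub i) hc)
    obtain ⟨s, rfl⟩ := (hQ J).mpr ⟨hJ, hJl⟩
    have hlt : s < i := by
      by_contra hge
      have h1 := hQsum i s (not_lt.mp hge)
      have h2 := sum_lowerAt_lt (hsub i) hc
      omega
    exact (lacunarIdeal_mono k hJn).trans (le_iSup₂_of_le s hlt le_rfl)
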